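/- Let $G=(V,E)$ be a finite undirected multigraph (loops and parallel edges are allowed) and let $f:V\to\mathbb{Z}_{\ge 0}$. A \emph{partial $f$-factor} is a set $M\subseteq E$ such that every vertex $v$ satisfies $d(v,M)\le f(v)$, where $d(v,M)$ is the number of edges of $M$ incident to $v$, loops at $v$ being counted twice. For $S\subseteq V$ write $f(S)=\sum_{v\in S}f(v)$, let $\gamma(S)$ be the set of edges with both ends in $S$ (including loops), and for disjoint $S,T\subseteq V$ let $E[S,T]$ be the set of edges joining a vertex of $S$ to a vertex of $T$. Then the maximum size $|M|$ of a partial $f$-factor of $G$ equals $$\min_{I,O}\ \Big\{\, f(I)+|\gamma(O)|+\sum_{C}\Big\lfloor \frac{f(C)+|E[C,O]|}{2}\Big\rfloor \Big\},$$ where $I$ and $O$ range over all pairs of disjoint (possibly empty) subsets of $V$, and in the sum $C$ ranges over the vertex sets of the connected components of $G-I-O$, the graph obtained from $G$ by deleting the vertices of $I\cup O$. -/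

import Mathlib

open scoped Graph

namespace Graph

variable {α β : Type*}

/-- The degree `d(v, M)` of the vertex `v` in the edge set `M` of the multigraph `G`;
a loop of `M` at `v` counts twice. -/
noncomputable def degreeIn (G : Graph α β) (M : Set β) (v : α) : ℕ :=
  {e ∈ M | G.Inc e v}.ncard + {e ∈ M | G.IsLoopAt e v}.ncard

/-- `M` is (the edge set of) a partial `f`-factor of `G`: a set of edges having degree
at most `f v` at each vertex `v`. -/
def IsPartialFactor (G : Graph α β) (f : α → ℕ) (M : Set β) : Prop :=
  M ⊆ E(G) ∧ ∀ v ∈ V(G), G.degreeIn M v ≤ f v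

/-- The vertex sets of the connected components of `G`. -/
def componentSets (G : Graph α β) : Set (Set α) :=
  {C | ∃ v ∈ V(G), C = {w | Relation.ReflTransGen G.Adj v w}}

/-- `γ(S)`, the set of edges of `G` with both ends in `S`. -/
def edgesInside (G : Graph α β) (S : Set α) : Set β :=
  {e | ∃ x ∈ S, ∃ y ∈ S, G.IsLink e x y}

/-- `E[S, T]`, the set of edges of `G` joining a vertex of `S` to a vertex of `T`. -/
def edgesBetween (G : Graph α β) (S T : Set α) : Set β :=
  {e | ∃ x ∈ S, ∃ y ∈ T, G.IsLink e x y}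

/-- `f(I) + |γ(O)| + ∑_C ⌊(f(C) + |E[C, O]|) / 2⌋`, where `f(S)` is the sum of `f` over `S`,
and `C` ranges over the connected components of `G - I - O`. -/
noncomputable def factorBound (G : Graph α β) (f : α → ℕ) (I O : Set α) : ℕ :=
  (∑ᶠ v ∈ I, f v) + (G.edgesInside O).ncard +
    ∑ᶠ C ∈ (G.deleteVerts (I ∪ O)).componentSets,
      ((∑ᶠ v ∈ C, f v) + (G.edgesBetween C O).ncard) / 2

end Graph

/-!
The theorem is a min-max formula of Tutte-Berge type, and the proof is a form of Gallai's argument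
for factor-critical components, carried out on degree vectors.

Weak duality (`Graph.IsPartialFactor.card_le_factorBound`) is counting: an edge of a partial factor
has an end in `I`, or lies inside `O`, or meets exactly one component `C` of `G - I - O`, and an
edge of the last kind uses two of the `f(C) + |E[C, O]|` units of its component.

For strong duality (`Graph.exists_factorBound_le`) the capacities are changed one unit at a time.
If lowering `f v` by one lowers the maximum, the formula for the lowered capacities suffices, since
for fixed `I` and `O` the bound grows by at most one; if raising some `f v < d(v)` by one does not
raise the maximum, the formula for the raised capacities suffices, since the bound is monotone in
`f`. When neither applies, `I` is the set of vertices of capacity zero and `O` the set of the other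
vertices with `d(v) ≤ f v`. It remains to see that on each component `C` a maximum partial factor
misses at most one of the `f(C) + |E[C, O]|` units (`Graph.IsCritical.capacity_le`).

To treat the missed edges to `O` like missed capacity at vertices, the ends in `O` of each edge are
moved to a private new vertex, which is harmless as the vertices of `O` do not constrain anything.
Gallai's relation "no maximum partial factor leaves capacity at both `x` and `y`" is then reflexive
on the vertices of `C` (`IncidenceSystem.not_jointlyExposed_self`), holds between adjacent ones
(`IncidenceSystem.not_jointlyExposed_of_edge`) and is transitive
(`IncidenceSystem.JointlyExposed.or_of_exposed`), hence holds for all pairs of units of `C`.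

All three facts come from the exchange property of degree vectors
(`IncidenceSystem.exists_exchange`), the two-step axiom of jump systems for two edge sets:
a step from the first degree vector towards the second can be completed, by a second step towards
it, to the degree vector of an edge set between the two. The completing trail is found by
following alternating edges one at a time, with no decomposition into trails.
-/

open scoped Graph

/-! ### Degrees and the exchange property -/

namespace IncidenceSystem

open Finset

variable {W β : Type*}

open Classical in
/-- The unit vector at `x`. -/
noncomputable def chi (x w : W) : ℤ := if w = x then 1 else 0

/-- The degree of `w` in the edge set `M`, where the edge `e` has incidence vector `c e`. -/
def degSum (c : β → W → ℤ) (M : Finset β) (w : W) : ℤ := ∑ e ∈ M, c e w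

/-- `v` is the incidence vector of an edge with ends `x` and `y` (possibly equal). -/
def IsEdgeVector (v : W → ℤ) : Prop := ∃ x y, ∀ w, v w = chi x w + chi y w

lemma chi_self (x : W) : chi x x = 1 := by simp [chi]

lemma chi_of_ne {x w : W} (h : w ≠ x) : chi x w = 0 := by simp [chi, h]

lemma chi_nonneg (x w : W) : 0 ≤ chi x w := by unfold chi; split_ifs <;> simp

lemma IsEdgeVector.nonneg {v : W → ℤ} (h : IsEdgeVector v) (w : W) : 0 ≤ v w := by
  obtain ⟨x, y, h⟩ := h
  rw [h]
  exact add_nonneg (chi_nonneg _ _) (chi_nonneg _ _)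

lemma IsEdgeVector.exists_other_end {v : W → ℤ} (h : IsEdgeVector v) {x : W} (hx : 0 < v x) :
    ∃ y, ∀ w, v w = chi x w + chi y w := by
  obtain ⟨a, b, h⟩ := h
  by_cases ha : x = a
  · subst ha; exact ⟨b, h⟩
  by_cases hb : x = b
  · subst hb; exact ⟨a, fun w => by rw [h, add_comm]⟩
  rw [h, chi_of_ne ha, chi_of_ne hb] at hx
  simp at hx

section
open Classical

lemma degSum_union_add_inter (c : β → W → ℤ) (M N : Finset β) (w : W) :
    degSum c (M ∪ N) w + degSum c (M ∩ N) w = degSum c M w + degSum c N w :=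
  sum_union_inter

lemma degSum_insert (c : β → W → ℤ) {M : Finset β} {e : β} (he : e ∉ M) (w : W) :
    degSum c (insert e M) w = degSum c M w + c e w := by
  rw [degSum, sum_insert he, add_comm, degSum]

lemma degSum_erase (c : β → W → ℤ) {M : Finset β} {e : β} (he : e ∈ M) (w : W) :
    degSum c (M.erase e) w = degSum c M w - c e w := by
  rw [degSum, degSum, ← sum_erase_add _ _ he]; ring

lemma exists_edge_of_degSum_lt {c : β → W → ℤ} {M N : Finset β} {v : W} (hc : ∀ e ∈ M, 0 ≤ c e v)
    (h : degSum c M v < degSum c N v) : ∃ e ∈ N, e ∉ M ∧ 0 < c e v := by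
  by_contra! hcon
  have h1 : degSum c N v = ∑ e ∈ N ∩ M, c e v + ∑ e ∈ N \ M, c e v :=
    (sum_inter_add_sum_sdiff N M _).symm
  have h2 : degSum c M v = ∑ e ∈ M ∩ N, c e v + ∑ e ∈ M \ N, c e v :=
    (sum_inter_add_sum_sdiff M N _).symm
  have h3 : ∑ e ∈ N \ M, c e v ≤ 0 := sum_nonpos fun e he => by
    rw [mem_sdiff] at he; exact hcon e he.1 he.2
  have h4 : 0 ≤ ∑ e ∈ M \ N, c e v := sum_nonneg fun e he => hc e (mem_sdiff.1 he).1
  rw [inter_comm] at h2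
  linarith

/-- An alternating trail from `v`: if a step of sign `ε` at `v` moves the degree vector of `M`
towards that of `N`, to the vector `q`, then some further step of sign `δ` from `q` towards the
degree vector of `N` reaches the degree vector of a set `K` between `M ∩ N` and `M ∪ N`.
The trail is followed edge by edge: after switching an edge `vw`, either `w` is a possible end,
or the trail goes on from `w` with the opposite sign and the *same* intermediate vector `q`. -/
theorem exists_degSum_eq_of_step (c : β → W → ℤ) (N : Finset β) (n : ℕ) :
    ∀ M : Finset β, (symmDiff M N).card = n → (∀ e ∈ M ∪ N, IsEdgeVector (c e)) →
    ∀ (q : W → ℤ) (Q : ℤ) (v : W) (ε : ℤ), (ε = 1 ∨ ε = -1) →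
    (∀ w, q w = degSum c M w + ε * chi v w) → Q = 2 * M.card + ε →
    0 < ε * (degSum c N v - degSum c M v) →
    ∃ (K : Finset β) (z : W) (δ : ℤ), M ∩ N ⊆ K ∧ K ⊆ M ∪ N ∧ (δ = 1 ∨ δ = -1) ∧
      (∀ w, degSum c K w = q w + δ * chi z w) ∧ 2 * (K.card : ℤ) = Q + δ ∧
      0 < δ * (degSum c N z - q z) := by
  induction n with
  | zero =>
    intro M hM _ q Q v ε _ _ _ h
    rw [card_eq_zero, symmDiff_eq_empty] at hM
    subst hM
    simp at h
  | succ n ih =>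
    intro M hM hc q Q v ε hε hq hQ h
    rcases hε with rfl | rfl
    · obtain ⟨e, heN, heM, hev⟩ := exists_edge_of_degSum_lt (v := v) (c := c) (M := M) (N := N)
        (fun e he => (hc e (mem_union_left _ he)).nonneg v) (by linarith)
      obtain ⟨w, hw⟩ := (hc e (mem_union_right _ heN)).exists_other_end hev
      have hdeg : ∀ u, degSum c (insert e M) u = q u + chi w u := fun u => by
        rw [degSum_insert c heM, hw, hq]; ring
      have hcard : ((insert e M).card : ℤ) = M.card + 1 := by
        rw [card_insert_of_notMem heM]; push_cast; ring
      by_cases hwN : q w < degSum c N w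
      · refine ⟨insert e M, w, 1, ?_, ?_, Or.inl rfl, ?_, by linarith, by linarith⟩
        · exact inter_subset_left.trans (subset_insert _ _)
        · exact insert_subset (mem_union_right _ heN) subset_union_left
        · intro u; rw [hdeg]; ring
      · have hU : insert e M ∪ N = M ∪ N := by
          rw [insert_union, insert_eq_self]; exact mem_union_right _ heN
        obtain ⟨K, z, δ, h1, h2, h3⟩ := ih (insert e M) (by
            have : symmDiff (insert e M) N = (symmDiff M N).erase e := by
              ext x; simp only [mem_symmDiff, mem_insert, mem_erase]
              by_cases hx : x = e
              · subst hx; simp [heN]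
              · simp [hx]
            rw [this, card_erase_of_mem (by simp [mem_symmDiff, heN, heM]), hM]; rfl)
          (by rw [hU]; exact hc) q Q w (-1) (Or.inr rfl) (fun u => by rw [hdeg]; ring)
          (by rw [hcard]; linarith)
          (by have := hdeg w; rw [chi_self] at this; linarith)
        exact ⟨K, z, δ, (inter_subset_inter_right (subset_insert _ _)).trans h1, hU ▸ h2, h3⟩
    · obtain ⟨e, heM, heN, hev⟩ := exists_edge_of_degSum_lt (v := v) (c := c) (M := N) (N := M)
        (fun e he => (hc e (mem_union_right _ he)).nonneg v) (by linarith)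
      obtain ⟨w, hw⟩ := (hc e (mem_union_left _ heM)).exists_other_end hev
      have hdeg : ∀ u, degSum c (M.erase e) u = q u - chi w u := fun u => by
        rw [degSum_erase c heM, hw, hq]; ring
      have hcard : ((M.erase e).card : ℤ) = M.card - 1 := by
        rw [cast_card_erase_of_mem heM]
      have hI : M ∩ N ⊆ M.erase e ∩ N := fun x hx => by
        rw [mem_inter] at hx
        exact mem_inter.2 ⟨mem_erase.2 ⟨fun h => heN (h ▸ hx.2), hx.1⟩, hx.2⟩
      by_cases hwN : degSum c N w < q w
      · refine ⟨M.erase e, w, -1, ?_, ?_, Or.inr rfl, ?_, by linarith, by linarith⟩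
        · exact hI.trans inter_subset_left
        · exact (erase_subset _ _).trans subset_union_left
        · intro u; rw [hdeg]; ring
      · have hU : M.erase e ∪ N ⊆ M ∪ N := union_subset_union_left (erase_subset _ _)
        obtain ⟨K, z, δ, h1, h2, h3⟩ := ih (M.erase e) (by
            have : symmDiff (M.erase e) N = (symmDiff M N).erase e := by
              ext x; simp only [mem_symmDiff, mem_erase]
              by_cases hx : x = e
              · subst hx; simp [heN]
              · simp [hx]
            rw [this, card_erase_of_mem (by simp [mem_symmDiff, heN, heM]), hM]; rfl)
          (fun e he => hc e (hU he)) q Q w 1 (Or.inl rfl) (fun u => by rw [hdeg]; ring)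
          (by rw [hcard]; linarith)
          (by have := hdeg w; rw [chi_self] at this; linarith)
        exact ⟨K, z, δ, hI.trans h1, h2.trans hU, h3⟩

/-- The exchange property of degree vectors, with both exchanged sets: `K` is obtained from `M`,
and `L` from `N`, by switching the same alternating trail. -/
theorem exists_exchange {c : β → W → ℤ} {M N : Finset β} (hc : ∀ e ∈ M ∪ N, IsEdgeVector (c e))
    {v : W} {ε : ℤ} (hε : ε = 1 ∨ ε = -1) (h : 0 < ε * (degSum c N v - degSum c M v)) :
    ∃ (K L : Finset β) (z : W) (δ : ℤ), K ⊆ M ∪ N ∧ L ⊆ M ∪ N ∧ (δ = 1 ∨ δ = -1) ∧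
      (∀ w, degSum c K w = degSum c M w + ε * chi v w + δ * chi z w) ∧
      (∀ w, degSum c L w = degSum c N w - ε * chi v w - δ * chi z w) ∧
      2 * (K.card : ℤ) = 2 * M.card + ε + δ ∧ 2 * (L.card : ℤ) = 2 * N.card - ε - δ ∧
      0 < δ * (degSum c N z - (degSum c M z + ε * chi v z)) := by
  obtain ⟨K, z, δ, h1, h2, hδ, h3, h4, h5⟩ := exists_degSum_eq_of_step c N _ M rfl hc
    (fun w => degSum c M w + ε * chi v w) _ v ε hε (fun _ => rfl) rfl h
  have hU : K ∪ (M ∩ N ∪ (M ∪ N) \ K) = M ∪ N := by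
    ext x
    have a := @h1 x
    have b := @h2 x
    simp only [mem_union, mem_inter, mem_sdiff] at a b ⊢
    tauto
  have hI : K ∩ (M ∩ N ∪ (M ∪ N) \ K) = M ∩ N := by
    ext x
    have a := @h1 x
    have b := @h2 x
    simp only [mem_union, mem_inter, mem_sdiff] at a b ⊢
    tauto
  refine ⟨K, M ∩ N ∪ (M ∪ N) \ K, z, δ, h2, ?_, hδ, h3, ?_, h4, ?_, h5⟩
  · exact union_subset (inter_subset_left.trans subset_union_left) sdiff_subset
  · intro w
    have := degSum_union_add_inter c K (M ∩ N ∪ (M ∪ N) \ K) w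
    rw [hU, hI, degSum_union_add_inter, h3] at this
    linarith
  · have := card_union_add_card_inter K (M ∩ N ∪ (M ∪ N) \ K)
    rw [hU, hI, card_union_add_card_inter] at this
    omega

end

end IncidenceSystem

/-! ### Joint exposure and Gallai's lemma -/

namespace IncidenceSystem

open Finset

variable {W β : Type*}

/-- `M ⊆ E` satisfies the degree constraints `f`. -/
def Feasible (c : β → W → ℤ) (E : Finset β) (f : W → ℤ) (M : Finset β) : Prop :=
  M ⊆ E ∧ ∀ w, degSum c M w ≤ f w

/-- Some feasible set of size `k` has one unit of capacity left at `x` and, simultaneously, a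
further unit at `y`; for `x = y` this means two units at `x`. With `k` the maximum size, this is
the negation of Gallai's equivalence relation. -/
def JointlyExposed (c : β → W → ℤ) (E : Finset β) (f : W → ℤ) (k : ℕ) (x y : W) : Prop :=
  ∃ M ⊆ E, M.card = k ∧ ∀ w, degSum c M w + chi x w + chi y w ≤ f w

variable {c : β → W → ℤ} {E : Finset β} {f : W → ℤ} {k : ℕ}

lemma JointlyExposed.symm {x y : W} (h : JointlyExposed c E f k x y) :
    JointlyExposed c E f k y x := by
  obtain ⟨M, hM, hk, h⟩ := h
  exact ⟨M, hM, hk, fun w => by linarith [h w]⟩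

open Classical in
/-- If `M` is a maximum feasible set with room at `x`, and relaxing the constraint at `x` by one
allows a larger set, then there is such a larger set with the degrees of `M`, except for two more
units at `x`. -/
lemma exists_degSum_add_two (hc : ∀ e ∈ E, IsEdgeVector (c e))
    (hmax : ∀ M, Feasible c E f M → M.card ≤ k) {x : W} {M' : Finset β} (hM' : M' ⊆ E)
    (hk' : M'.card = k + 1) (hf' : ∀ w, degSum c M' w ≤ f w + chi x w)
    {M : Finset β} (hM : M ⊆ E) (hk : M.card = k) (hf : ∀ w, degSum c M w + chi x w ≤ f w) :
    ∃ K ⊆ E, K.card = k + 1 ∧ ∀ w, degSum c K w = degSum c M w + 2 * chi x w := by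
  have hgt : f x < degSum c M' x := by
    by_contra! hle
    have := hmax M' ⟨hM', fun w => by
      by_cases hw : w = x
      · subst hw; exact hle
      · have := hf' w; rw [chi_of_ne hw] at this; linarith⟩
    omega
  have hx := hf x
  rw [chi_self] at hx
  obtain ⟨K, L, z, δ, hK, hL, hδ, hdK, hdL, hcK, hcL, hz⟩ := exists_exchange (c := c) (M := M)
    (N := M') (fun e he => hc e (union_subset hM hM' he)) (v := x) (ε := 1) (Or.inl rfl)
    (by linarith)
  have hU := union_subset hM hM'
  rcases hδ with rfl | rfl
  · by_cases hzx : z = x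
    · subst hzx
      exact ⟨K, hK.trans hU, by omega, fun w => by rw [hdK]; ring⟩
    · exfalso
      have := hmax K ⟨hK.trans hU, fun w => by
        rw [hdK]
        by_cases hw : w = z
        · subst hw
          have := hf' w
          rw [chi_of_ne hzx] at hz this ⊢
          rw [chi_self]
          linarith
        · rw [chi_of_ne hw]
          linarith [hf w]⟩
      omega
  · exfalso
    have := hmax L ⟨hL.trans hU, fun w => by
      rw [hdL]
      by_cases hw : w = z
      · subst hw
        rw [chi_self]
        linarith [hf w, chi_nonneg x w]
      · rw [chi_of_ne hw]
        linarith [hf' w]⟩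
    omega

/-- If relaxing the constraint at `x` by one allows a larger set, then no maximum feasible set
has two units of capacity left at `x`. -/
lemma not_jointlyExposed_self (hc : ∀ e ∈ E, IsEdgeVector (c e))
    (hmax : ∀ M, Feasible c E f M → M.card ≤ k) {x : W} {M' : Finset β} (hM' : M' ⊆ E)
    (hk' : M'.card = k + 1) (hf' : ∀ w, degSum c M' w ≤ f w + chi x w) :
    ¬ JointlyExposed c E f k x x := by
  rintro ⟨M, hM, hk, hf⟩
  obtain ⟨K, hK, hKk, hd⟩ := exists_degSum_add_two hc hmax hM' hk' hf' hM hk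
    fun w => by linarith [hf w, chi_nonneg x w]
  have := hmax K ⟨hK, fun w => by rw [hd]; linarith [hf w]⟩
  omega

open Classical in
/-- Transitivity in Gallai's lemma: if `x` and `y` are jointly exposed and `t` can be exposed, then
`t` is jointly exposed with `x` or with `y`. -/
lemma JointlyExposed.or_of_exposed (hc : ∀ e ∈ E, IsEdgeVector (c e))
    (hmax : ∀ M, Feasible c E f M → M.card ≤ k) {x y t : W}
    (h : JointlyExposed c E f k x y) {N : Finset β} (hN : N ⊆ E) (hNk : N.card = k)
    (hNf : ∀ w, degSum c N w + chi t w ≤ f w) :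
    JointlyExposed c E f k x t ∨ JointlyExposed c E f k t y := by
  obtain ⟨M, hM, hk, hf⟩ := id h
  have hU := union_subset hM hN
  by_cases hlt : degSum c N t < degSum c M t
  · obtain ⟨K, L, z, δ, hK, hL, hδ, hdK, hdL, hcK, hcL, hz⟩ := exists_exchange (c := c) (M := M)
      (N := N) (fun e he => hc e (hU he)) (v := t) (ε := -1) (Or.inr rfl)
      (by linarith)
    rcases hδ with rfl | rfl
    · by_cases hzx : z = x
      · subst hzx
        exact Or.inr ⟨K, hK.trans hU, by omega, fun w => by rw [hdK]; linarith [hf w]⟩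
      · refine Or.inl ⟨K, hK.trans hU, by omega, fun w => ?_⟩
        rw [hdK]
        by_cases hw : w = z
        · subst hw
          rw [chi_of_ne hzx, chi_self]
          linarith [hNf w]
        · rw [chi_of_ne hw]
          linarith [hf w, chi_nonneg y w]
    · exfalso
      have := hmax L ⟨hL.trans hU, fun w => by
        rw [hdL]
        by_cases hw : w = z
        · subst hw
          rw [chi_self]
          linarith [hf w, chi_nonneg x w, chi_nonneg y w]
        · rw [chi_of_ne hw]
          linarith [hNf w]⟩
      omega
  · by_cases htx : t = x
    · subst htx; exact Or.inr h
    · refine Or.inl ⟨M, hM, hk, fun w => ?_⟩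
      by_cases hw : w = t
      · subst hw
        have := hNf w
        rw [chi_self] at this ⊢
        rw [chi_of_ne htx]
        linarith
      · rw [chi_of_ne hw]
        linarith [hf w, chi_nonneg y w]

/-- A maximum feasible set with capacity left at both ends of an edge contains that edge. -/
lemma mem_of_ends_exposed (hmax : ∀ M, Feasible c E f M → M.card ≤ k) {x y : W} {e : β}
    (he : e ∈ E) (hxy : ∀ w, c e w = chi x w + chi y w) {M : Finset β} (hM : M ⊆ E)
    (hk : M.card = k) (hf : ∀ w, degSum c M w + chi x w + chi y w ≤ f w) : e ∈ M := by
  classical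
  by_contra heM
  have := hmax (insert e M) ⟨insert_subset he hM, fun w => by
    rw [degSum_insert c heM, hxy]; linarith [hf w]⟩
  rw [card_insert_of_notMem heM] at this
  omega

open Classical in
/-- Adjacency in Gallai's lemma: the ends of an edge are not jointly exposed, provided that
relaxing the constraint at either end by one allows a larger set. -/
lemma not_jointlyExposed_of_edge (hc : ∀ e ∈ E, IsEdgeVector (c e))
    (hmax : ∀ M, Feasible c E f M → M.card ≤ k) {x y : W} {e : β} (he : e ∈ E)
    (hxy : ∀ w, c e w = chi x w + chi y w)
    (hx : ∃ M' ⊆ E, M'.card = k + 1 ∧ ∀ w, degSum c M' w ≤ f w + chi x w)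
    (hy : ∃ M' ⊆ E, M'.card = k + 1 ∧ ∀ w, degSum c M' w ≤ f w + chi y w) :
    ¬ JointlyExposed c E f k x y := by
  obtain ⟨Mx, hMx, hkx, hfx⟩ := hx
  obtain ⟨My, hMy, hky, hfy⟩ := hy
  have hrx := not_jointlyExposed_self hc hmax hMx hkx hfx
  have hry := not_jointlyExposed_self hc hmax hMy hky hfy
  intro hj
  have hne : x ≠ y := by rintro rfl; exact hrx hj
  obtain ⟨M, hM, hk, hf⟩ := hj
  -- Two larger sets, with two units more than `M` at `x` and at `y`; both avoid `e`.
  obtain ⟨A, hA, hAk, hdA⟩ := exists_degSum_add_two hc hmax hMx hkx hfx hM hk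
    fun w => by linarith [hf w, chi_nonneg y w]
  obtain ⟨B, hB, hBk, hdB⟩ := exists_degSum_add_two hc hmax hMy hky hfy hM hk
    fun w => by linarith [hf w, chi_nonneg x w]
  have heA : e ∉ A := fun heA => hry ⟨A.erase e, (erase_subset _ _).trans hA, by
    rw [card_erase_of_mem heA, hAk]; rfl, fun w => by
    rw [degSum_erase c heA, hdA, hxy]; linarith [hf w]⟩
  have heB : e ∉ B := fun heB => hrx ⟨B.erase e, (erase_subset _ _).trans hB, by
    rw [card_erase_of_mem heB, hBk]; rfl, fun w => by
    rw [degSum_erase c heB, hdB, hxy]; linarith [hf w]⟩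
  obtain ⟨K, L, z, δ, hK, hL, hδ, hdK, hdL, hcK, hcL, hz⟩ := exists_exchange (c := c) (M := B)
    (N := A) (fun e he => hc e (union_subset hB hA he)) (v := x) (ε := 1) (Or.inl rfl)
    (by rw [hdA, hdB, chi_self, chi_of_ne hne]; linarith)
  have hU := union_subset hB hA
  rw [hdA, hdB] at hz
  rcases hδ with rfl | rfl
  · have hzx : z = x := by
      by_contra hzx
      rw [chi_of_ne hzx] at hz
      linarith [chi_nonneg y z]
    subst hzx
    have := mem_of_ends_exposed hmax he hxy (hL.trans hU) (by omega)
      fun w => by rw [hdL, hdA]; linarith [hf w]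
    rcases mem_union.1 (hL this) with h | h
    · exact heB h
    · exact heA h
  · have hzy : z = y := by
      by_contra hzy
      rw [chi_of_ne hzy] at hz
      linarith [chi_nonneg x z]
    subst hzy
    have := hmax K ⟨hK.trans hU, fun w => by rw [hdK, hdB]; linarith [hf w]⟩
    omega

end IncidenceSystem

/-! ### Incidence vectors of a multigraph -/

namespace Graph

open Finset IncidenceSystem

variable {α β : Type*} {G : Graph α β}

open Classical in
/-- The incidence vector of the edge `e`: its entry at `v` is the number of ends of `e` equal to
`v`. -/
noncomputable def incVec (G : Graph α β) (e : β) (v : α) : ℤ :=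
  (if G.Inc e v then 1 else 0) + (if G.IsLoopAt e v then 1 else 0)

lemma IsLink.incVec_eq {e : β} {x y : α} (h : G.IsLink e x y) (w : α) :
    G.incVec e w = chi x w + chi y w := by
  classical
  have h1 : G.Inc e w ↔ w = x ∨ w = y := by
    constructor
    · exact fun hw => hw.eq_or_eq_of_isLink h
    · rintro (rfl | rfl)
      · exact h.inc_left
      · exact h.inc_right
  have h2 : G.IsLoopAt e w ↔ w = x ∧ w = y := by
    constructor
    · intro hw
      exact ⟨hw.eq_of_inc h.inc_left, hw.eq_of_inc h.inc_right⟩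
    · rintro ⟨rfl, rfl⟩
      exact h
  simp only [incVec, chi, h1, h2]
  by_cases hx : w = x <;> by_cases hy : w = y <;> simp [hx, hy, add_comm]

lemma incVec_nonneg (G : Graph α β) (e : β) (v : α) : 0 ≤ G.incVec e v := by
  unfold incVec; split_ifs <;> simp

lemma one_le_incVec {e : β} {v : α} (h : G.Inc e v) : 1 ≤ G.incVec e v := by
  unfold incVec; rw [if_pos h]; split_ifs <;> simp

lemma incVec_eq_zero {e : β} {v : α} (h : ¬ G.Inc e v) : G.incVec e v = 0 := by
  unfold incVec; rw [if_neg h, if_neg fun hl => h hl.inc]; rfl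

lemma coe_degreeIn (G : Graph α β) (M : Finset β) (v : α) :
    (G.degreeIn (M : Set β) v : ℤ) = degSum G.incVec M v := by
  classical
  have key : ∀ p : β → Prop, {e ∈ (M : Set β) | p e}.ncard = (M.filter p).card := fun p => by
    rw [← Set.ncard_coe_finset]; congr 1; ext; simp
  unfold degreeIn degSum incVec
  rw [key, key, sum_add_distrib, sum_boole, sum_boole]
  push_cast
  rfl

lemma degSum_incVec_mono (G : Graph α β) {M N : Finset β} (h : M ⊆ N) (v : α) :
    degSum G.incVec M v ≤ degSum G.incVec N v :=
  sum_le_sum_of_subset_of_nonneg h fun e _ _ => G.incVec_nonneg e v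

lemma degSum_incVec_of_notMem (G : Graph α β) (M : Finset β) {v : α} (hv : v ∉ V(G)) :
    degSum G.incVec M v = 0 :=
  sum_eq_zero fun _ _ => incVec_eq_zero fun h => hv h.vertex_mem

lemma IsPartialFactor.degSum_le {f : α → ℕ} {M : Finset β}
    (h : G.IsPartialFactor f (M : Set β)) (v : α) : degSum G.incVec M v ≤ f v := by
  by_cases hv : v ∈ V(G)
  · rw [← coe_degreeIn]; exact_mod_cast h.2 v hv
  · rw [degSum_incVec_of_notMem _ _ hv]; positivity

lemma isPartialFactor_of_degSum_le {f : α → ℕ} {M : Finset β} (hM : (M : Set β) ⊆ E(G))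
    (h : ∀ v, degSum G.incVec M v ≤ f v) : G.IsPartialFactor f (M : Set β) :=
  ⟨hM, fun v _ => by have := h v; rw [← coe_degreeIn] at this; exact_mod_cast this⟩

lemma IsPartialFactor.subset {f : α → ℕ} {M N : Finset β}
    (h : G.IsPartialFactor f (M : Set β)) (hN : N ⊆ M) : G.IsPartialFactor f (N : Set β) :=
  isPartialFactor_of_degSum_le (fun _ he => h.1 (hN he))
    fun v => (G.degSum_incVec_mono hN v).trans (h.degSum_le v)

/-! ### Components -/

lemma subset_of_mem_componentSets {C : Set α} (hC : C ∈ G.componentSets) : C ⊆ V(G) := by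
  obtain ⟨v, hv, rfl⟩ := hC
  intro w hw
  change Relation.ReflTransGen G.Adj v w at hw
  induction hw with
  | refl => exact hv
  | tail _ h _ => exact h.right_mem

lemma reflTransGen_adj_symm {x y : α} (h : Relation.ReflTransGen G.Adj x y) :
    Relation.ReflTransGen G.Adj y x := by
  induction h with
  | refl => exact .refl
  | tail _ h ih => exact .head h.symm ih

lemma reflTransGen_of_mem_componentSets {C : Set α} (hC : C ∈ G.componentSets) {x y : α}
    (hx : x ∈ C) (hy : y ∈ C) : Relation.ReflTransGen G.Adj x y := by
  obtain ⟨v, _, rfl⟩ := hC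
  exact (reflTransGen_adj_symm hx).trans hy

lemma mem_of_adj_of_mem_componentSets {C : Set α} (hC : C ∈ G.componentSets) {x y : α}
    (hx : x ∈ C) (h : G.Adj x y) : y ∈ C := by
  obtain ⟨v, _, rfl⟩ := hC
  exact Relation.ReflTransGen.tail hx h

lemma eq_of_mem_componentSets {C D : Set α} (hC : C ∈ G.componentSets)
    (hD : D ∈ G.componentSets) {x : α} (hxC : x ∈ C) (hxD : x ∈ D) : C = D := by
  have h {A B : Set α} (hA : A ∈ G.componentSets) (hB : B ∈ G.componentSets) (hxA : x ∈ A)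
      (hxB : x ∈ B) : A ⊆ B := fun y hy => by
    have := reflTransGen_of_mem_componentSets hA hxA hy
    obtain ⟨v, _, rfl⟩ := hB
    exact Relation.ReflTransGen.trans hxB this
  exact (h hC hD hxC hxD).antisymm (h hD hC hxD hxC)

lemma exists_mem_componentSets {x : α} (hx : x ∈ V(G)) : ∃ C ∈ G.componentSets, x ∈ C :=
  ⟨_, ⟨x, hx, rfl⟩, Relation.ReflTransGen.refl⟩

lemma finite_componentSets (hV : V(G).Finite) : G.componentSets.Finite :=
  hV.finite_subsets.subset fun _ hC => subset_of_mem_componentSets hC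

lemma finite_vertexSet_deleteVerts (hV : V(G).Finite) (X : Set α) :
    V(G.deleteVerts X).Finite := by
  rw [vertexSet_deleteVerts]; exact hV.subset Set.sdiff_subset

lemma mem_of_mem_component_deleteVerts {X C : Set α} (hC : C ∈ (G.deleteVerts X).componentSets)
    {x : α} (hx : x ∈ C) : x ∈ V(G) ∧ x ∉ X := by
  have := subset_of_mem_componentSets hC hx
  rwa [vertexSet_deleteVerts] at this

/-! ### The bound as a function of the capacities -/

lemma factorBound_eq (hV : V(G).Finite) (f : α → ℕ) {I : Set α} (hI : I ⊆ V(G)) (O : Set α) :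
    G.factorBound f I O = ∑ v ∈ (hV.subset hI).toFinset, f v + (G.edgesInside O).ncard +
      ∑ C ∈ (finite_componentSets (finite_vertexSet_deleteVerts hV (I ∪ O))).toFinset,
        ((∑ᶠ v ∈ C, f v) + (G.edgesBetween C O).ncard) / 2 := by
  rw [factorBound, finsum_mem_eq_finite_toFinset_sum _ (hV.subset hI),
    finsum_mem_eq_finite_toFinset_sum]

lemma finite_of_mem_component_deleteVerts (hV : V(G).Finite) {X C : Set α}
    (hC : C ∈ (G.deleteVerts X).componentSets) : C.Finite :=
  hV.subset fun _ hx => (mem_of_mem_component_deleteVerts hC hx).1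

lemma factorBound_mono (hV : V(G).Finite) {f g : α → ℕ} (hfg : f ≤ g) {I : Set α}
    (hI : I ⊆ V(G)) (O : Set α) : G.factorBound f I O ≤ G.factorBound g I O := by
  rw [factorBound_eq hV f hI, factorBound_eq hV g hI]
  gcongr with v _ C hC
  · exact hfg v
  · rw [Set.Finite.mem_toFinset] at hC
    have hCf := finite_of_mem_component_deleteVerts hV hC
    rw [finsum_mem_eq_finite_toFinset_sum _ hCf, finsum_mem_eq_finite_toFinset_sum _ hCf]
    exact sum_le_sum fun v _ => hfg v

open Classical in
/-- Lowering one capacity by one lowers the bound by at most one, since the vertex lies in at most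
one of `I` and the components. -/
lemma factorBound_le_update_add_one (hV : V(G).Finite) (f : α → ℕ) (v : α) {I : Set α}
    (hI : I ⊆ V(G)) (O : Set α) :
    G.factorBound f I O ≤ G.factorBound (Function.update f v (f v - 1)) I O + 1 := by
  rw [factorBound_eq hV f hI, factorBound_eq hV _ hI]
  set g := Function.update f v (f v - 1) with hg
  set 𝒞 := (finite_componentSets (finite_vertexSet_deleteVerts hV (I ∪ O))).toFinset with h𝒞
  have hfg : ∀ w, f w ≤ g w + if w = v then 1 else 0 := fun w => by
    by_cases hw : w = v
    · subst hw; simp [hg]; omega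
    · simp [hg, hw]
  have hsum : ∀ S : Finset α, ∑ w ∈ S, f w ≤ ∑ w ∈ S, g w + if v ∈ S then 1 else 0 := fun S => by
    calc ∑ w ∈ S, f w ≤ ∑ w ∈ S, (g w + if w = v then 1 else 0) := sum_le_sum fun w _ => hfg w
      _ = _ := by rw [sum_add_distrib, sum_ite_eq']
  have h1 := hsum (hV.subset hI).toFinset
  have h2 : ∑ C ∈ 𝒞, ((∑ᶠ w ∈ C, f w) + (G.edgesBetween C O).ncard) / 2 ≤
      ∑ C ∈ 𝒞, ((∑ᶠ w ∈ C, g w) + (G.edgesBetween C O).ncard) / 2 +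
        (𝒞.filter (fun C => v ∈ C)).card := by
    rw [card_filter, ← sum_add_distrib]
    refine sum_le_sum fun C hC => ?_
    rw [h𝒞, Set.Finite.mem_toFinset] at hC
    have hCf := finite_of_mem_component_deleteVerts hV hC
    rw [finsum_mem_eq_finite_toFinset_sum _ hCf, finsum_mem_eq_finite_toFinset_sum _ hCf]
    have := hsum hCf.toFinset
    simp only [Set.Finite.mem_toFinset] at this
    split_ifs at this ⊢ <;> omega
  have h3 : (𝒞.filter (fun C => v ∈ C)).card + (if v ∈ (hV.subset hI).toFinset then 1 else 0)
      ≤ 1 := by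
    split_ifs with hvI
    · rw [Set.Finite.mem_toFinset] at hvI
      rw [filter_false_of_mem]
      · simp
      · intro C hC hvC
        rw [h𝒞, Set.Finite.mem_toFinset] at hC
        exact (mem_of_mem_component_deleteVerts hC hvC).2 (Or.inl hvI)
    · rw [add_zero, card_le_one]
      intro C hC D hD
      rw [mem_filter, h𝒞, Set.Finite.mem_toFinset] at hC hD
      exact eq_of_mem_componentSets hC.1 hD.1 hC.2 hD.2
  omega

end Graph

/-! ### Counting edges by components -/

namespace Graph

open Finset IncidenceSystem

variable {α β : Type*} {G : Graph α β}

open Classical in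
/-- The edges of `M` that have an end in `C` and no end in `I`. -/
noncomputable def edgesMeeting (G : Graph α β) (M : Finset β) (I C : Set α) : Finset β :=
  M.filter fun e => (∃ x ∈ C, G.Inc e x) ∧ ∀ x ∈ I, ¬ G.Inc e x

lemma mem_edgesMeeting {M : Finset β} {I C : Set α} {e : β} :
    e ∈ G.edgesMeeting M I C ↔ e ∈ M ∧ (∃ x ∈ C, G.Inc e x) ∧ ∀ x ∈ I, ¬ G.Inc e x := by
  classical
  rw [edgesMeeting, mem_filter]

lemma edgesMeeting_subset (M : Finset β) (I C : Set α) : G.edgesMeeting M I C ⊆ M :=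
  fun _ he => (mem_edgesMeeting.1 he).1

lemma exists_end_of_mem_edgesMeeting {M : Finset β} {I O C : Set α}
    (hC : C ∈ (G.deleteVerts (I ∪ O)).componentSets) {e : β} (he : e ∈ G.edgesMeeting M I C) :
    e ∈ M ∧ ∃ x ∈ C, ∃ y, G.IsLink e x y ∧ (y ∈ C ∨ y ∈ O) := by
  rw [mem_edgesMeeting] at he
  obtain ⟨heM, ⟨x, hxC, y, hxy⟩, hI⟩ := he
  refine ⟨heM, x, hxC, y, hxy, ?_⟩
  by_cases hyO : y ∈ O
  · exact Or.inr hyO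
  · refine Or.inl (mem_of_adj_of_mem_componentSets hC hxC ⟨e, ?_⟩)
    rw [deleteVerts_isLink]
    refine ⟨hxy, (mem_of_mem_component_deleteVerts hC hxC).2, ?_⟩
    rintro (hyI | hyO')
    · exact hI y hyI hxy.inc_right
    · exact hyO hyO'

open Classical in
/-- An edge from `C` to `C ∪ O` has two units in total: its ends in `C`, and one for membership in
`E[C, O]`. -/
lemma sum_incVec_add_eq_two {C : Finset α} {O : Set α} (hCO : Disjoint (C : Set α) O) {e : β}
    {x y : α} (h : G.IsLink e x y) (hx : x ∈ C) (hy : y ∈ C ∨ y ∈ O) :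
    ∑ v ∈ C, G.incVec e v + (if e ∈ G.edgesBetween C O then 1 else 0) = 2 := by
  have hsum : ∑ v ∈ C, G.incVec e v = (if x ∈ C then 1 else 0) + if y ∈ C then 1 else 0 := by
    simp only [h.incVec_eq, sum_add_distrib, chi, sum_ite_eq']
  have hnot : ∀ z ∈ C, z ∉ O := fun z hz hzO =>
    Set.disjoint_left.1 hCO (mem_coe.2 hz) hzO
  rw [hsum, if_pos hx]
  rcases hy with hy | hy
  · have : e ∉ G.edgesBetween C O := by
      rintro ⟨a, _, b, hb, hab⟩
      rcases hab.symm.left_eq_or_eq h with rfl | rfl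
      exacts [hnot _ hx hb, hnot _ hy hb]
    rw [if_pos hy, if_neg this]
    rfl
  · have hyC : y ∉ C := fun hyC => hnot y hyC hy
    rw [if_neg hyC, if_pos ⟨x, mem_coe.2 hx, y, hy, h⟩]
    rfl

open Classical in
lemma two_mul_card_edgesMeeting {M : Finset β} {I O : Set α} {C : Finset α}
    (hC : (C : Set α) ∈ (G.deleteVerts (I ∪ O)).componentSets) :
    2 * ((G.edgesMeeting M I C).card : ℤ) =
      ∑ v ∈ C, degSum G.incVec (G.edgesMeeting M I C) v +
        ((G.edgesMeeting M I C).filter (· ∈ G.edgesBetween C O)).card := by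
  have hCO : Disjoint (C : Set α) O := Set.disjoint_left.2 fun x hx hxO =>
    (mem_of_mem_component_deleteVerts hC hx).2 (Or.inr hxO)
  have : ∑ e ∈ G.edgesMeeting M I C,
      (∑ v ∈ C, G.incVec e v + (if e ∈ G.edgesBetween C O then 1 else 0)) =
      ∑ e ∈ G.edgesMeeting M I C, (2 : ℤ) := sum_congr rfl fun e he => by
    obtain ⟨_, x, hx, y, hxy, hy⟩ := exists_end_of_mem_edgesMeeting hC he
    exact sum_incVec_add_eq_two hCO hxy (mem_coe.1 hx) hy
  rw [sum_const, nsmul_eq_mul, sum_add_distrib, sum_comm, sum_boole] at this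
  unfold degSum
  rw [this]
  ring

lemma disjoint_edgesMeeting {M : Finset β} {I O C D : Set α}
    (hC : C ∈ (G.deleteVerts (I ∪ O)).componentSets)
    (hD : D ∈ (G.deleteVerts (I ∪ O)).componentSets) (hne : C ≠ D) :
    Disjoint (G.edgesMeeting M I C) (G.edgesMeeting M I D) := by
  rw [Finset.disjoint_left]
  intro e heC heD
  obtain ⟨_, x, hx, y, hxy, hy⟩ := exists_end_of_mem_edgesMeeting hC heC
  rw [mem_edgesMeeting] at heD
  obtain ⟨_, ⟨z, hz, hze⟩, _⟩ := heD
  have hzO := (mem_of_mem_component_deleteVerts hD hz).2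
  rcases hze.eq_or_eq_of_isLink hxy with rfl | rfl
  · exact hne (eq_of_mem_componentSets hC hD hx hz)
  · rcases hy with hy | hy
    · exact hne (eq_of_mem_componentSets hC hD hy hz)
    · exact hzO (Or.inr hy)

open Classical in
/-- Weak duality. -/
theorem IsPartialFactor.card_le_factorBound (hV : V(G).Finite) (hE : E(G).Finite) {f : α → ℕ}
    {M : Finset β} (hM : G.IsPartialFactor f (M : Set β)) {I : Set α} (hI : I ⊆ V(G)) (O : Set α) :
    M.card ≤ G.factorBound f I O := by
  rw [factorBound_eq hV f hI]
  set 𝒞 := (finite_componentSets (finite_vertexSet_deleteVerts hV (I ∪ O))).toFinset with h𝒞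
  have hcover : M ⊆ (hV.subset hI).toFinset.biUnion (fun v => M.filter (G.Inc · v)) ∪
      M.filter (· ∈ G.edgesInside O) ∪ 𝒞.biUnion (G.edgesMeeting M I) := by
    intro e he
    by_cases heI : ∃ v ∈ I, G.Inc e v
    · obtain ⟨v, hv, hev⟩ := heI
      refine mem_union_left _ (mem_union_left _ (mem_biUnion.2 ⟨v, ?_, mem_filter.2 ⟨he, hev⟩⟩))
      exact (Set.Finite.mem_toFinset _).2 hv
    push Not at heI
    by_cases heO : e ∈ G.edgesInside O
    · exact mem_union_left _ (mem_union_right _ (mem_filter.2 ⟨he, heO⟩))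
    · obtain ⟨x, y, hxy⟩ := exists_isLink_of_mem_edgeSet (hM.1 he)
      have : ∃ z, G.Inc e z ∧ z ∉ O := by
        by_contra! hcon
        exact heO ⟨x, hcon x hxy.inc_left, y, hcon y hxy.inc_right, hxy⟩
      obtain ⟨z, hz, hzO⟩ := this
      obtain ⟨C, hC, hzC⟩ := exists_mem_componentSets (G := G.deleteVerts (I ∪ O)) (x := z) (by
        rw [vertexSet_deleteVerts]
        exact ⟨hz.vertex_mem, by rintro (h | h); exacts [heI z h hz, hzO h]⟩)
      refine mem_union_right _ (mem_biUnion.2 ⟨C, ?_, ?_⟩)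
      · rwa [h𝒞, Set.Finite.mem_toFinset]
      · exact mem_edgesMeeting.2 ⟨he, ⟨z, hzC, hz⟩, heI⟩
  refine (card_le_card hcover).trans ((card_union_le _ _).trans (add_le_add
    ((card_union_le _ _).trans (add_le_add (card_biUnion_le.trans (sum_le_sum fun v _ => ?_)) ?_))
    (card_biUnion_le.trans (sum_le_sum fun C hC => ?_))))
  · have h1 : ((M.filter (G.Inc · v)).card : ℤ) ≤ degSum G.incVec M v := by
      rw [card_filter, degSum]
      push_cast
      refine sum_le_sum fun e _ => ?_
      split_ifs with h
      · exact one_le_incVec h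
      · exact G.incVec_nonneg e v
    exact_mod_cast h1.trans (hM.degSum_le v)
  · rw [← Set.ncard_coe_finset]
    refine Set.ncard_le_ncard (fun e he => (mem_filter.1 (mem_coe.1 he)).2) (hE.subset ?_)
    rintro e ⟨x, _, y, _, h⟩
    exact h.edge_mem
  · rw [h𝒞, Set.Finite.mem_toFinset] at hC
    have hCf := finite_of_mem_component_deleteVerts hV hC
    lift C to Finset α using hCf
    have h2 := two_mul_card_edgesMeeting (M := M) hC
    have h3 : ∑ v ∈ C, degSum G.incVec (G.edgesMeeting M I C) v ≤ ∑ v ∈ C, (f v : ℤ) :=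
      sum_le_sum fun v _ => (G.degSum_incVec_mono (edgesMeeting_subset _ _ _) v).trans (hM.degSum_le v)
    have h4 : ((G.edgesMeeting M I C).filter (· ∈ G.edgesBetween C O)).card ≤
        (G.edgesBetween C O).ncard := by
      rw [← Set.ncard_coe_finset]
      refine Set.ncard_le_ncard (fun e he => (mem_filter.1 (mem_coe.1 he)).2) (hE.subset ?_)
      rintro e ⟨x, _, y, _, h⟩
      exact h.edge_mem
    rw [finsum_mem_coe_finset]
    have h5 : ((∑ v ∈ C, f v : ℕ) : ℤ) = ∑ v ∈ C, (f v : ℤ) := by push_cast; rfl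
    omega

end Graph

/-! ### Detaching the edges from `O` -/

namespace Graph

open Finset IncidenceSystem

variable {α β : Type*} {G : Graph α β}

open Classical in
/-- The number of ends in `O` of the edge `e`. -/
noncomputable def numEnds (G : Graph α β) (O : Set α) (e : β) : ℤ :=
  (if ∃ x ∈ O, G.Inc e x then 1 else 0) + (if e ∈ G.edgesInside O then 1 else 0)

open Classical in
/-- The incidence vector of `e` after all its ends in `O` have been moved to a new private vertex
`Sum.inr e`. -/
noncomputable def splitVec (G : Graph α β) (O : Set α) (e : β) : α ⊕ β → ℤ :=
  Sum.elim (fun v => if v ∈ O then 0 else G.incVec e v)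
    (fun e' => if e' = e then G.numEnds O e else 0)

/-- The capacities after detaching the edges from `O`: each new vertex can take all ends of its
edge. -/
noncomputable def splitCap (G : Graph α β) (f : α → ℕ) (O : Set α) : α ⊕ β → ℤ :=
  Sum.elim (fun v => (f v : ℤ)) (G.numEnds O)

lemma numEnds_nonneg (G : Graph α β) (O : Set α) (e : β) : 0 ≤ G.numEnds O e := by
  unfold numEnds; split_ifs <;> simp

open Classical in
lemma IsLink.numEnds_eq {e : β} {x y : α} (h : G.IsLink e x y) (O : Set α) :
    G.numEnds O e = (if x ∈ O then 1 else 0) + (if y ∈ O then 1 else 0) := by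
  have h1 : (∃ z ∈ O, G.Inc e z) ↔ x ∈ O ∨ y ∈ O := by
    constructor
    · rintro ⟨z, hz, hze⟩
      rcases hze.eq_or_eq_of_isLink h with rfl | rfl
      exacts [Or.inl hz, Or.inr hz]
    · rintro (hx | hy)
      exacts [⟨x, hx, h.inc_left⟩, ⟨y, hy, h.inc_right⟩]
  have h2 : e ∈ G.edgesInside O ↔ x ∈ O ∧ y ∈ O := by
    constructor
    · rintro ⟨a, ha, b, hb, hab⟩
      rcases h.eq_and_eq_or_eq_and_eq hab with ⟨rfl, rfl⟩ | ⟨rfl, rfl⟩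
      exacts [⟨ha, hb⟩, ⟨hb, ha⟩]
    · rintro ⟨hx, hy⟩
      exact ⟨x, hx, y, hy, h⟩
  rw [numEnds, if_congr h1 rfl rfl, if_congr h2 rfl rfl]
  by_cases hx : x ∈ O <;> by_cases hy : y ∈ O <;> simp [hx, hy]

lemma chi_inl_inl (x v : α) : chi (Sum.inl x : α ⊕ β) (Sum.inl v) = chi x v := by
  by_cases h : v = x <;> simp [chi, h]

lemma chi_inl_inr (x : α) (e : β) : chi (Sum.inl x : α ⊕ β) (Sum.inr e) = 0 := by
  simp [chi]

open Classical in
lemma IsLink.splitVec_eq {e : β} {x y : α} (h : G.IsLink e x y) (O : Set α) (w : α ⊕ β) :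
    G.splitVec O e w = chi (if x ∈ O then Sum.inr e else Sum.inl x) w +
      chi (if y ∈ O then Sum.inr e else Sum.inl y) w := by
  have hmid : ∀ (z v : α), chi (if z ∈ O then Sum.inr e else Sum.inl z : α ⊕ β) (Sum.inl v) =
      if v ∈ O then 0 else chi z v := fun z v => by
    by_cases hz : z ∈ O
    · by_cases hv : v ∈ O
      · simp [chi, hz, hv]
      · have : v ≠ z := fun hvz => hv (hvz ▸ hz)
        simp [chi, hz, hv, this]
    · by_cases hv : v ∈ O
      · have : v ≠ z := fun hvz => hz (hvz ▸ hv)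
        simp [chi, hz, hv, this]
      · simp [chi, hz, hv]
  have hright : ∀ (z : α) (e' : β),
      chi (if z ∈ O then Sum.inr e else Sum.inl z : α ⊕ β) (Sum.inr e') =
      if e' = e then (if z ∈ O then 1 else 0) else 0 := fun z e' => by
    by_cases hz : z ∈ O <;> by_cases he : e' = e <;> simp [chi, hz, he]
  rcases w with v | e'
  · rw [hmid, hmid, splitVec, Sum.elim_inl, h.incVec_eq]
    split_ifs <;> simp
  · rw [hright, hright, splitVec, Sum.elim_inr, h.numEnds_eq]
    split_ifs <;> simp

lemma isEdgeVector_splitVec {e : β} (he : e ∈ E(G)) (O : Set α) :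
    IsEdgeVector (G.splitVec O e) := by
  obtain ⟨x, y, h⟩ := exists_isLink_of_mem_edgeSet he
  exact ⟨_, _, h.splitVec_eq O⟩

open Classical in
lemma degSum_splitVec_inl (G : Graph α β) (O : Set α) (M : Finset β) (v : α) :
    degSum (G.splitVec O) M (Sum.inl v) = if v ∈ O then 0 else degSum G.incVec M v := by
  simp only [degSum, splitVec, Sum.elim_inl]
  split_ifs <;> simp

open Classical in
lemma degSum_splitVec_inr (G : Graph α β) (O : Set α) (M : Finset β) (e : β) :
    degSum (G.splitVec O) M (Sum.inr e) = if e ∈ M then G.numEnds O e else 0 := by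
  simp only [degSum, splitVec, Sum.elim_inr, sum_ite_eq]

lemma degSum_splitVec_inr_le (G : Graph α β) (O : Set α) (M : Finset β) (e : β) :
    degSum (G.splitVec O) M (Sum.inr e) ≤ G.numEnds O e := by
  rw [degSum_splitVec_inr]
  split_ifs
  exacts [le_rfl, G.numEnds_nonneg O e]

lemma degSum_splitVec_inl_of_notMem (G : Graph α β) {O : Set α} (M : Finset β) {v : α}
    (hv : v ∉ O) : degSum (G.splitVec O) M (Sum.inl v) = degSum G.incVec M v := by
  rw [degSum_splitVec_inl, if_neg hv]

lemma degSum_splitVec_inl_of_mem (G : Graph α β) {O : Set α} (M : Finset β) {v : α}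
    (hv : v ∈ O) : degSum (G.splitVec O) M (Sum.inl v) = 0 := by
  rw [degSum_splitVec_inl, if_pos hv]

/-- Detaching does not change which edge sets are feasible, when every vertex of `O` has enough
capacity for all its edges. -/
lemma feasible_splitVec_iff {f : α → ℕ} {O : Set α} {E M : Finset β} (hE : (E : Set β) = E(G))
    (hO : ∀ v ∈ O, degSum G.incVec E v ≤ f v) :
    Feasible (G.splitVec O) E (G.splitCap f O) M ↔ G.IsPartialFactor f (M : Set β) := by
  constructor
  · rintro ⟨hM, hf⟩
    refine isPartialFactor_of_degSum_le (by rw [← hE]; exact_mod_cast hM) fun v => ?_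
    by_cases hv : v ∈ O
    · exact (G.degSum_incVec_mono hM v).trans (hO v hv)
    · rw [← G.degSum_splitVec_inl_of_notMem M hv]
      exact hf (Sum.inl v)
  · intro h
    refine ⟨by have := h.1; rw [← hE] at this; exact_mod_cast this, ?_⟩
    rintro (v | e)
    · by_cases hv : v ∈ O
      · rw [G.degSum_splitVec_inl_of_mem M hv]
        exact Int.natCast_nonneg _
      · rw [G.degSum_splitVec_inl_of_notMem M hv]
        exact h.degSum_le v
    · exact G.degSum_splitVec_inr_le O M e

/-! ### Components of a critical instance -/

/-- A nonnegative integer function without two (possibly equal) units on `U` has sum at most one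
on `U`. -/
lemma sum_le_one_of_not_chi_add_chi_le {ι : Type*} {g : ι → ℤ} (hg : ∀ w, 0 ≤ g w) {U : Finset ι}
    (h : ∀ u ∈ U, ∀ u' ∈ U, ¬ ∀ w, chi u w + chi u' w ≤ g w) : ∑ u ∈ U, g u ≤ 1 := by
  classical
  by_contra! hlt
  obtain ⟨u, hu, hgu⟩ : ∃ u ∈ U, 0 < g u := exists_lt_of_sum_lt (by simp; linarith)
  obtain ⟨u', hu', hgu'⟩ : ∃ u' ∈ U, chi u u' < g u' := exists_lt_of_sum_lt (by
    simp only [chi, sum_ite_eq', hu, if_true]; exact hlt)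
  refine h u hu u' hu' fun w => ?_
  by_cases hw : w = u'
  · subst hw
    rw [chi_self]
    linarith
  · rw [chi_of_ne hw]
    by_cases hwu : w = u
    · subst hwu
      rw [chi_self]
      linarith
    · rw [chi_of_ne hwu]
      linarith [hg w]

/-- An instance to which no reduction applies: `k` is an upper bound for the size of partial
`f`-factors, vertices of `O` have capacity for all their edges, and for each vertex `v` outside `I`
and `O` some partial factor of size `k` leaves capacity at `v`, while one more unit of capacity at
`v` allows size `k + 1`. -/
structure IsCritical (G : Graph α β) (E : Finset β) (f : α → ℕ) (k : ℕ) (I O : Set α) : Prop where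
  coe_eq : (E : Set β) = E(G)
  card_le : ∀ M : Finset β, G.IsPartialFactor f (M : Set β) → M.card ≤ k
  degSum_le : ∀ v ∈ O, degSum G.incVec E v ≤ f v
  exists_exposed : ∀ v ∈ V(G), v ∉ I ∪ O → ∃ N ⊆ E, N.card = k ∧
    ∀ w, degSum G.incVec N w + chi v w ≤ f w
  exists_larger : ∀ v ∈ V(G), v ∉ I ∪ O → ∃ N ⊆ E, N.card = k + 1 ∧
    ∀ w, degSum G.incVec N w ≤ f w + chi v w

section Critical

variable {E : Finset β} {f : α → ℕ} {k : ℕ} {I O : Set α}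

lemma IsCritical.isEdgeVector (h : G.IsCritical E f k I O) :
    ∀ e ∈ E, IsEdgeVector (G.splitVec O e) := fun e he =>
  isEdgeVector_splitVec (by rw [← h.coe_eq]; exact_mod_cast he) O

lemma IsCritical.card_le_of_feasible (h : G.IsCritical E f k I O) (M : Finset β)
    (hM : Feasible (G.splitVec O) E (G.splitCap f O) M) : M.card ≤ k :=
  h.card_le M ((feasible_splitVec_iff h.coe_eq h.degSum_le).1 hM)

lemma IsCritical.exists_exposed_split (h : G.IsCritical E f k I O) {v : α} (hv : v ∈ V(G))
    (hvIO : v ∉ I ∪ O) : ∃ N ⊆ E, N.card = k ∧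
      ∀ w, degSum (G.splitVec O) N w + chi (Sum.inl v) w ≤ G.splitCap f O w := by
  obtain ⟨N, hN, hk, hf⟩ := h.exists_exposed v hv hvIO
  refine ⟨N, hN, hk, ?_⟩
  rintro (w | e)
  · rw [chi_inl_inl]
    by_cases hw : w ∈ O
    · rw [G.degSum_splitVec_inl_of_mem N hw, chi_of_ne (x := v) fun hwv => hvIO (Or.inr (hwv ▸ hw))]
      exact Int.natCast_nonneg _
    · rw [G.degSum_splitVec_inl_of_notMem N hw]
      exact hf w
  · rw [chi_inl_inr, add_zero]
    exact G.degSum_splitVec_inr_le O N e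

lemma IsCritical.exists_larger_split (h : G.IsCritical E f k I O) {v : α} (hv : v ∈ V(G))
    (hvIO : v ∉ I ∪ O) : ∃ N ⊆ E, N.card = k + 1 ∧
      ∀ w, degSum (G.splitVec O) N w ≤ G.splitCap f O w + chi (Sum.inl v) w := by
  obtain ⟨N, hN, hk, hf⟩ := h.exists_larger v hv hvIO
  refine ⟨N, hN, hk, ?_⟩
  rintro (w | e)
  · rw [chi_inl_inl]
    by_cases hw : w ∈ O
    · rw [G.degSum_splitVec_inl_of_mem N hw]
      exact add_nonneg (Int.natCast_nonneg _) (chi_nonneg _ _)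
    · rw [G.degSum_splitVec_inl_of_notMem N hw]
      exact hf w
  · rw [chi_inl_inr, add_zero]
    exact G.degSum_splitVec_inr_le O N e

/-- Gallai's lemma on the vertices of a component: no two of them, equal or not, are jointly
exposed. -/
lemma IsCritical.not_jointlyExposed_inl_inl (h : G.IsCritical E f k I O) {C : Set α}
    (hC : C ∈ (G.deleteVerts (I ∪ O)).componentSets) {x y : α} (hx : x ∈ C) (hy : y ∈ C) :
    ¬ JointlyExposed (G.splitVec O) E (G.splitCap f O) k (Sum.inl x) (Sum.inl y) := by
  have hmem : ∀ z, z ∈ C → z ∈ V(G) ∧ z ∉ I ∪ O :=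
    fun z hz => mem_of_mem_component_deleteVerts hC hz
  have hpath := reflTransGen_of_mem_componentSets hC hx hy
  clear hy
  suffices y ∈ C ∧ ¬ JointlyExposed (G.splitVec O) E (G.splitCap f O) k (Sum.inl x) (Sum.inl y)
    from this.2
  induction hpath with
  | refl =>
    obtain ⟨N, hN, hk, hf⟩ := h.exists_larger_split (hmem x hx).1 (hmem x hx).2
    exact ⟨hx, not_jointlyExposed_self h.isEdgeVector h.card_le_of_feasible hN hk hf⟩
  | @tail t y _ hty ih =>
    obtain ⟨ht, hxt⟩ := ih
    have hy := mem_of_adj_of_mem_componentSets hC ht hty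
    refine ⟨hy, fun hxy => ?_⟩
    obtain ⟨e, he⟩ := hty
    rw [deleteVerts_isLink] at he
    obtain ⟨N, hN, hk, hf⟩ := h.exists_exposed_split (hmem t ht).1 (hmem t ht).2
    rcases hxy.or_of_exposed h.isEdgeVector h.card_le_of_feasible hN hk hf with hj | hj
    · exact hxt hj
    · refine not_jointlyExposed_of_edge h.isEdgeVector h.card_le_of_feasible (e := e) ?_ ?_
        (h.exists_larger_split (hmem t ht).1 (hmem t ht).2)
        (h.exists_larger_split (hmem y hy).1 (hmem y hy).2) hj
      · rw [← mem_coe, h.coe_eq]; exact he.1.edge_mem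
      · intro w
        rw [he.1.splitVec_eq, if_neg fun hO => he.2.1 (Or.inr hO),
          if_neg fun hO => he.2.2 (Or.inr hO)]

lemma IsCritical.not_jointlyExposed_inl_inr (h : G.IsCritical E f k I O) {C : Set α}
    (hC : C ∈ (G.deleteVerts (I ∪ O)).componentSets) {x : α} (hx : x ∈ C) {e : β}
    (he : e ∈ G.edgesBetween C O) :
    ¬ JointlyExposed (G.splitVec O) E (G.splitCap f O) k (Sum.inl x) (Sum.inr e) := by
  obtain ⟨t, ht, o, ho, hto⟩ := he
  have htm := mem_of_mem_component_deleteVerts hC ht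
  have htO : t ∉ O := fun hO => htm.2 (Or.inr hO)
  intro hj
  obtain ⟨N, hN, hk, hf⟩ := h.exists_exposed_split htm.1 htm.2
  rcases hj.or_of_exposed h.isEdgeVector h.card_le_of_feasible hN hk hf with hj | hj
  · exact h.not_jointlyExposed_inl_inl hC hx ht hj
  · obtain ⟨M, hM, hMk, hMf⟩ := hj
    have heM : e ∈ M := by
      refine mem_of_ends_exposed h.card_le_of_feasible (e := e) ?_ ?_ hM hMk hMf
      · rw [← mem_coe, h.coe_eq]; exact hto.edge_mem
      · intro w
        rw [hto.splitVec_eq, if_neg htO, if_pos ho]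
    -- The private end of an edge of `M` has no capacity left.
    have := hMf (Sum.inr e)
    rw [degSum_splitVec_inr, if_pos heM, chi_inl_inr, chi_self, splitCap, Sum.elim_inr] at this
    linarith

lemma IsCritical.not_jointlyExposed_inr_inr (h : G.IsCritical E f k I O) {C : Set α}
    (hC : C ∈ (G.deleteVerts (I ∪ O)).componentSets) {e e' : β}
    (he : e ∈ G.edgesBetween C O) (he' : e' ∈ G.edgesBetween C O) :
    ¬ JointlyExposed (G.splitVec O) E (G.splitCap f O) k (Sum.inr e) (Sum.inr e') := by
  obtain ⟨t, ht, _⟩ := id he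
  have htm := mem_of_mem_component_deleteVerts hC ht
  intro hj
  obtain ⟨N, hN, hk, hf⟩ := h.exists_exposed_split htm.1 htm.2
  rcases hj.or_of_exposed h.isEdgeVector h.card_le_of_feasible hN hk hf with hj | hj
  · exact h.not_jointlyExposed_inl_inr hC ht he hj.symm
  · exact h.not_jointlyExposed_inl_inr hC ht he' hj

open Classical in
/-- In a critical instance the total deficiency of a maximum partial factor on a component,
counting also the missed edges to `O`, is at most one. -/
lemma IsCritical.capacity_le (h : G.IsCritical E f k I O) {C : Finset α}
    (hC : (C : Set α) ∈ (G.deleteVerts (I ∪ O)).componentSets) {M : Finset β}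
    (hM : G.IsPartialFactor f (M : Set β)) (hk : M.card = k) :
    ∑ v ∈ C, (f v : ℤ) + (G.edgesBetween C O).ncard ≤
      ∑ v ∈ C, degSum G.incVec M v + (M.filter (· ∈ G.edgesBetween C O)).card + 1 := by
  have hfeas := (feasible_splitVec_iff h.coe_eq h.degSum_le).2 hM
  have hCO : ∀ v ∈ C, v ∉ O := fun v hv hO =>
    (mem_of_mem_component_deleteVerts hC (mem_coe.2 hv)).2 (Or.inr hO)
  have hBE : G.edgesBetween C O ⊆ E := by
    rw [h.coe_eq]
    rintro e ⟨x, _, y, _, hxy⟩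
    exact hxy.edge_mem
  set B := E.filter (· ∈ G.edgesBetween C O) with hB
  have hBmem : ∀ e, e ∈ B ↔ e ∈ G.edgesBetween C O := fun e => by
    rw [hB, mem_filter]; exact ⟨And.right, fun he => ⟨mem_coe.1 (hBE he), he⟩⟩
  have hBcard : (G.edgesBetween C O).ncard = B.card := by
    rw [← Set.ncard_coe_finset]; congr 1; ext e; rw [mem_coe, hBmem]
  have hBM : M.filter (· ∈ G.edgesBetween C O) = B.filter (· ∈ M) := by
    ext e; rw [mem_filter, mem_filter, hBmem, and_comm]
  have key := sum_le_one_of_not_chi_add_chi_le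
    (g := fun w => G.splitCap f O w - degSum (G.splitVec O) M w)
    (fun w => sub_nonneg.2 (hfeas.2 w)) (U := C.disjSum B) (by
      intro u hu u' hu' hg
      have hj : JointlyExposed (G.splitVec O) E (G.splitCap f O) k u u' :=
        ⟨M, hfeas.1, hk, fun w => by linarith [hg w]⟩
      rw [mem_disjSum] at hu hu'
      rcases hu with ⟨x, hx, rfl⟩ | ⟨e, he, rfl⟩ <;> rcases hu' with ⟨y, hy, rfl⟩ | ⟨e', he', rfl⟩
      · exact h.not_jointlyExposed_inl_inl hC hx hy hj
      · exact h.not_jointlyExposed_inl_inr hC hx ((hBmem _).1 he') hj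
      · exact h.not_jointlyExposed_inl_inr hC hy ((hBmem _).1 he) hj.symm
      · exact h.not_jointlyExposed_inr_inr hC ((hBmem _).1 he) ((hBmem _).1 he') hj)
  rw [sum_disjSum] at key
  have h1 : ∑ v ∈ C, (G.splitCap f O (Sum.inl v) - degSum (G.splitVec O) M (Sum.inl v)) =
      ∑ v ∈ C, (f v : ℤ) - ∑ v ∈ C, degSum G.incVec M v := by
    rw [← sum_sub_distrib]
    exact sum_congr rfl fun v hv => by
      rw [G.degSum_splitVec_inl_of_notMem M (hCO v hv)]; rfl
  have h2 : ∑ e ∈ B, (G.splitCap f O (Sum.inr e) - degSum (G.splitVec O) M (Sum.inr e)) =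
      B.card - (B.filter (· ∈ M)).card := by
    rw [card_eq_sum_ones, card_filter]
    push_cast
    rw [← sum_sub_distrib]
    refine sum_congr rfl fun e he => ?_
    obtain ⟨x, hx, y, hy, hxy⟩ := (hBmem e).1 he
    rw [degSum_splitVec_inr, splitCap, Sum.elim_inr, hxy.numEnds_eq, if_neg (hCO x hx), if_pos hy]
    simp
  rw [h1, h2] at key
  rw [hBM, hBcard]
  linarith

end Critical

end Graph

/-! ### Strong duality -/

namespace Graph

open Finset IncidenceSystem

variable {α β : Type*} {G : Graph α β}

open Classical in
/-- A critical instance attains the bound when the vertices of `I` have capacity zero. -/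
theorem IsCritical.factorBound_le {E : Finset β} {f : α → ℕ} {k : ℕ} {I O : Set α}
    (h : G.IsCritical E f k I O) (hV : V(G).Finite) (hI : I ⊆ V(G)) (hI0 : ∀ v ∈ I, f v = 0)
    {M : Finset β} (hM : G.IsPartialFactor f (M : Set β)) (hk : M.card = k) :
    G.factorBound f I O ≤ k := by
  rw [factorBound_eq hV f hI]
  set 𝒞 := (finite_componentSets (finite_vertexSet_deleteVerts hV (I ∪ O))).toFinset with h𝒞
  have hMI : ∀ e ∈ M, ∀ v ∈ I, ¬ G.Inc e v := fun e he v hv hev => by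
    have h1 : G.incVec e v ≤ degSum G.incVec M v :=
      single_le_sum (f := fun e => G.incVec e v) (fun e _ => G.incVec_nonneg e v) he
    have h2 := hM.degSum_le v
    rw [hI0 v hv] at h2
    have h3 := one_le_incVec hev
    simp at h2
    linarith
  have hinside : G.edgesInside O ⊆ M := by
    rintro e ⟨x, hx, y, hy, hxy⟩
    by_contra heM
    rw [mem_coe] at heM
    have heE : e ∈ E := by rw [← mem_coe, h.coe_eq]; exact hxy.edge_mem
    have hME : M ⊆ E := by rw [← coe_subset, h.coe_eq]; exact hM.1
    have := h.card_le (insert e M) (isPartialFactor_of_degSum_le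
      (by rw [← h.coe_eq, coe_subset]; exact insert_subset heE hME) fun v => by
        by_cases hv : v ∈ O
        · exact (G.degSum_incVec_mono (insert_subset heE hME) v).trans (h.degSum_le v hv)
        · rw [degSum_insert _ heM, incVec_eq_zero, add_zero]
          · exact hM.degSum_le v
          · intro hev
            rcases hev.eq_or_eq_of_isLink hxy with rfl | rfl
            exacts [hv hx, hv hy])
    rw [card_insert_of_notMem heM] at this
    omega
  have hcomp : ∀ C ∈ 𝒞, ((∑ᶠ v ∈ C, f v) + (G.edgesBetween C O).ncard) / 2 ≤
      (G.edgesMeeting M I C).card := by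
    intro C hC
    rw [h𝒞, Set.Finite.mem_toFinset] at hC
    have hCf := finite_of_mem_component_deleteVerts hV hC
    lift C to Finset α using hCf
    have h1 := two_mul_card_edgesMeeting (M := M) hC
    have h2 := h.capacity_le hC hM hk
    have h3 : (G.edgesMeeting M I C).filter (· ∈ G.edgesBetween C O) =
        M.filter (· ∈ G.edgesBetween C O) := by
      ext e
      simp only [mem_filter, mem_edgesMeeting]
      constructor
      · rintro ⟨⟨he, _⟩, heB⟩
        exact ⟨he, heB⟩
      · rintro ⟨he, heB⟩
        obtain ⟨x, hx, y, hy, hxy⟩ := id heB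
        exact ⟨⟨he, ⟨x, hx, hxy.inc_left⟩, hMI e he⟩, heB⟩
    have h4 : ∑ v ∈ C, degSum G.incVec (G.edgesMeeting M I C) v =
        ∑ v ∈ C, degSum G.incVec M v := sum_congr rfl fun v hv => by
      refine sum_subset (edgesMeeting_subset M I C) fun e he hne => incVec_eq_zero fun hev => hne ?_
      exact mem_edgesMeeting.2 ⟨he, ⟨v, mem_coe.2 hv, hev⟩, hMI e he⟩
    rw [h3, h4] at h1
    rw [finsum_mem_coe_finset]
    have h5 : ((∑ v ∈ C, f v : ℕ) : ℤ) = ∑ v ∈ C, (f v : ℤ) := by push_cast; rfl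
    omega
  have hdisj : Disjoint (M.filter (· ∈ G.edgesInside O)) (𝒞.biUnion (G.edgesMeeting M I)) := by
    rw [Finset.disjoint_left]
    intro e he he'
    obtain ⟨x, hx, y, hy, hxy⟩ := (mem_filter.1 he).2
    obtain ⟨C, hC, heC⟩ := mem_biUnion.1 he'
    rw [h𝒞, Set.Finite.mem_toFinset] at hC
    obtain ⟨_, ⟨z, hz, hez⟩, _⟩ := mem_edgesMeeting.1 heC
    have hzO := (mem_of_mem_component_deleteVerts hC hz).2
    rcases hez.eq_or_eq_of_isLink hxy with rfl | rfl
    exacts [hzO (Or.inr hx), hzO (Or.inr hy)]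
  have hsum0 : ∑ v ∈ (hV.subset hI).toFinset, f v = 0 :=
    sum_eq_zero fun v hv => hI0 v ((Set.Finite.mem_toFinset _).1 hv)
  have hγ : (G.edgesInside O).ncard = (M.filter (· ∈ G.edgesInside O)).card := by
    rw [← Set.ncard_coe_finset]
    congr 1
    ext e
    rw [mem_coe, mem_filter]
    exact ⟨fun he => ⟨hinside he, he⟩, And.right⟩
  rw [hsum0, zero_add, hγ, ← hk]
  calc _ ≤ (M.filter (· ∈ G.edgesInside O)).card + ∑ C ∈ 𝒞, (G.edgesMeeting M I C).card :=
        Nat.add_le_add_left (sum_le_sum hcomp) _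
    _ = (M.filter (· ∈ G.edgesInside O)).card + (𝒞.biUnion (G.edgesMeeting M I)).card := by
        rw [card_biUnion]
        intro C hC D hD hne
        rw [mem_coe, h𝒞, Set.Finite.mem_toFinset] at hC hD
        exact disjoint_edgesMeeting hC hD hne
    _ = (M.filter (· ∈ G.edgesInside O) ∪ 𝒞.biUnion (G.edgesMeeting M I)).card :=
        (card_union_of_disjoint hdisj).symm
    _ ≤ M.card := card_le_card (union_subset (filter_subset _ _)
        (biUnion_subset.2 fun C _ => edgesMeeting_subset M I C))

lemma IsPartialFactor.mono {f g : α → ℕ} (hfg : f ≤ g) {M : Set β} (h : G.IsPartialFactor f M) :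
    G.IsPartialFactor g M :=
  ⟨h.1, fun v hv => (h.2 v hv).trans (hfg v)⟩

lemma exists_maximum_isPartialFactor (hE : E(G).Finite) (f : α → ℕ) :
    ∃ M : Finset β, G.IsPartialFactor f (M : Set β) ∧
      ∀ N : Finset β, G.IsPartialFactor f (N : Set β) → N.card ≤ M.card := by
  classical
  have h0 : G.IsPartialFactor f ((∅ : Finset β) : Set β) :=
    isPartialFactor_of_degSum_le (by simp) fun v => by simp [degSum]
  have hmem : ∀ N : Finset β, G.IsPartialFactor f (N : Set β) →
      N ∈ hE.toFinset.powerset.filter fun N : Finset β => G.IsPartialFactor f (N : Set β) :=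
    fun N hN => mem_filter.2 ⟨mem_powerset.2 fun e he => (Set.Finite.mem_toFinset _).2 (hN.1 he),
      hN⟩
  obtain ⟨M, hM, hmax⟩ := exists_max_image _ Finset.card ⟨_, hmem _ h0⟩
  exact ⟨M, (mem_filter.1 hM).2, fun N hN => hmax N (hmem N hN)⟩

open Classical in
/-- Strong duality, by induction on the maximum size `k` and then on the total amount by which the
capacities fall short of the degrees. If lowering a capacity lowers the maximum, the pair for the
lowered capacities still works, as the bound grows by at most one; if raising a capacity does not
raise the maximum, the pair for the raised capacities works. Otherwise the instance is critical. -/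
theorem exists_factorBound_le (hV : V(G).Finite) (hE : E(G).Finite) (k : ℕ) :
    ∀ (m : ℕ) (f : α → ℕ), (∀ N : Finset β, G.IsPartialFactor f (N : Set β) → N.card ≤ k) →
    (∃ M : Finset β, G.IsPartialFactor f (M : Set β) ∧ M.card = k) →
    ∑ v ∈ hV.toFinset, (G.degreeIn E(G) v - f v) = m →
    ∃ I O : Set α, I ⊆ V(G) ∧ O ⊆ V(G) ∧ Disjoint I O ∧ G.factorBound f I O ≤ k := by
  induction k using Nat.strong_induction_on with
  | _ k ihk =>
  intro m
  induction m using Nat.strong_induction_on with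
  | _ m ihm =>
  intro f hmax ⟨M, hM, hMk⟩ hm
  by_cases hlow : ∃ v, 0 < f v ∧ ∀ N : Finset β,
      G.IsPartialFactor (Function.update f v (f v - 1)) (N : Set β) → N.card < k
  · obtain ⟨v, _, hlt⟩ := hlow
    obtain ⟨N, hN, hNmax⟩ := exists_maximum_isPartialFactor hE (Function.update f v (f v - 1))
    have hNk := hlt N hN
    obtain ⟨I, O, hI, hO, hd, hb⟩ := ihk N.card hNk _ _ hNmax ⟨N, hN, rfl⟩ rfl
    exact ⟨I, O, hI, hO, hd, (factorBound_le_update_add_one hV f v hI O).trans (by omega)⟩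
  by_cases hhigh : ∃ v ∈ V(G), f v < G.degreeIn E(G) v ∧ ∀ N : Finset β,
      G.IsPartialFactor (Function.update f v (f v + 1)) (N : Set β) → N.card ≤ k
  · obtain ⟨v, hv, hdeg, hle⟩ := hhigh
    have hfg : f ≤ Function.update f v (f v + 1) := by
      rw [le_update_self_iff]
      exact Nat.le_succ _
    obtain ⟨I, O, hI, hO, hd, hb⟩ := ihm _ (by
      rw [← hm]
      refine sum_lt_sum (fun w _ => Nat.sub_le_sub_left (hfg w) _)
        ⟨v, (Set.Finite.mem_toFinset _).2 hv, ?_⟩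
      rw [Function.update_self]
      omega) _ hle ⟨M, hM.mono hfg, hMk⟩ rfl
    exact ⟨I, O, hI, hO, hd, (factorBound_mono hV hfg hI O).trans hb⟩
  push Not at hlow hhigh
  have hEc : (hE.toFinset : Set β) = E(G) := hE.coe_toFinset
  have hdegE : ∀ v, degSum G.incVec hE.toFinset v = G.degreeIn E(G) v := fun v => by
    rw [← coe_degreeIn, hEc]
  have hcrit : G.IsCritical hE.toFinset f k {v ∈ V(G) | f v = 0}
      {v ∈ V(G) | f v ≠ 0 ∧ G.degreeIn E(G) v ≤ f v} := by
    refine ⟨hEc, hmax, fun v hv => ?_, fun v hv hvIO => ?_, fun v hv hvIO => ?_⟩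
    · rw [hdegE]
      exact_mod_cast hv.2.2
    · have hfv : 0 < f v := Nat.pos_of_ne_zero fun h0 => hvIO (Or.inl ⟨hv, h0⟩)
      obtain ⟨N, hN, hNk⟩ := hlow v hfv
      have hNf : ∀ w, degSum G.incVec N w + chi v w ≤ f w := fun w => by
        have := hN.degSum_le w
        by_cases hw : w = v
        · subst hw
          rw [Function.update_self] at this
          rw [chi_self]
          omega
        · rw [Function.update_of_ne hw] at this
          rwa [chi_of_ne hw, add_zero]
      refine ⟨N, ?_, (hmax N (isPartialFactor_of_degSum_le hN.1 fun w => ?_)).antisymm hNk, hNf⟩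
      · rw [← coe_subset, hEc]; exact hN.1
      · linarith [hNf w, chi_nonneg v w]
    · have hfv : f v ≠ 0 := fun h0 => hvIO (Or.inl ⟨hv, h0⟩)
      have hdeg : f v < G.degreeIn E(G) v := by
        by_contra! hle
        exact hvIO (Or.inr ⟨hv, hfv, hle⟩)
      obtain ⟨N, hN, hNk⟩ := hhigh v hv hdeg
      obtain ⟨N', hN', hN'k⟩ := exists_subset_card_eq (Nat.succ_le_of_lt hNk)
      have hN'f := hN.subset hN'
      refine ⟨N', ?_, hN'k, fun w => ?_⟩
      · rw [← coe_subset, hEc]; exact hN'f.1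
      · have := hN'f.degSum_le w
        by_cases hw : w = v
        · subst hw
          rw [Function.update_self] at this
          rw [chi_self]
          push_cast at this
          exact this
        · rw [Function.update_of_ne hw] at this
          rwa [chi_of_ne hw, add_zero]
  refine ⟨_, _, fun v hv => hv.1, fun v hv => hv.1, ?_,
    hcrit.factorBound_le hV (fun v hv => hv.1) (fun v hv => hv.2) hM hMk⟩
  exact Set.disjoint_left.2 fun v hv hv' => hv'.2.1 hv.2

end Graph

/-- For a finite multigraph `G` (loops and parallel edges allowed) and `f : V(G) → ℕ`, the maximum
size of a partial `f`-factor and the minimum of the bound over all pairs of disjoint vertex sets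
`I`, `O` both exist and are equal. -/
theorem mainTheorem2 {α β : Type*} (G : Graph α β) (hV : V(G).Finite) (hE : E(G).Finite)
    (f : α → ℕ) :
    ∃ k : ℕ,
      IsGreatest {n : ℕ | ∃ M : Set β, G.IsPartialFactor f M ∧ M.ncard = n} k ∧
      IsLeast {n : ℕ | ∃ I O : Set α, I ⊆ V(G) ∧ O ⊆ V(G) ∧ Disjoint I O ∧
        G.factorBound f I O = n} k := by
  obtain ⟨M, hM, hmax⟩ := Graph.exists_maximum_isPartialFactor hE f
  obtain ⟨I, O, hI, hO, hd, hb⟩ :=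
    Graph.exists_factorBound_le hV hE M.card _ f hmax ⟨M, hM, rfl⟩ rfl
  refine ⟨M.card, ⟨⟨M, hM, Set.ncard_coe_finset M⟩, ?_⟩,
    ⟨I, O, hI, hO, hd, hb.antisymm (hM.card_le_factorBound hV hE hI O)⟩, ?_⟩
  · rintro n ⟨N, hN, rfl⟩
    lift N to Finset β using hE.subset hN.1
    rw [Set.ncard_coe_finset]
    exact hmax N hN
  · rintro n ⟨I', O', hI', _, _, rfl⟩
    exact hM.card_le_factorBound hV hE hI' O'
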